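/- Let $\kappa<0$, let $n\in\mathbb{N}$, and let $X$ be a $\operatorname{CAT}(\kappa)$-space, i.e. a metric space in which any two points are joined by a geodesic and in which the distance between any two points of any geodesic triangle is at most the distance between the corresponding points of a comparison triangle (one with the same side lengths) in the hyperbolic plane $M_\kappa^2$ of constant curvature $\kappa$. For a collection $\mathcal{U}$ of subsets of a metric space $Y$, the multiplicity of $\mathcal{U}$ is the maximal number of members of $\mathcal{U}$ with non-empty intersection, and the mesh of $\mathcal{U}$ is the supremum of the diameters of its members. A cover $\mathcal{U}$ of $Y$ has Lebesgue number at least $L>0$ if every open ball of radius $L$ in $Y$ is contained in some $U\in\mathcal{U}$. Let $x_0\in X$ and suppose that $X$ has nicely $n$-covered spheres with respect to the basepoint $x_0$: there are $\rho>0$, $\lambda>0$, $D$ and, for every $k\in\mathbb{N}=\{0,1,2,\dots\}$, a cover $\mathcal{U}_k$ of the sphere $S_{k\rho}(x_0)=\{x\in X\mid d(x,x_0)=k\rho\}$ (with the metric restricted from $X$) such that for all $k$ the cover $\mathcal{U}_k$ has Lebesgue number at least $\lambda$, mesh at most $D$, and multiplicity at most $n$. Then $\operatorname{asdim}(X)\leq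 n$, i.e. for every $L>0$ there are $D'>0$ and a cover of $X$ with multiplicity at most $n+1$, Lebesgue number at least $L$, and mesh at most $D'$. -/

import Mathlib

open scoped UpperHalfPlane ENNReal

namespace CATAsdim

noncomputable section

/-! ### Covers and asymptotic dimension -/

/-- `𝒰` is a cover of the space `X`. -/
def IsCover {X : Type*} (𝒰 : Set (Set X)) : Prop :=
  ⋃₀ 𝒰 = Set.univ

/-- The multiplicity of a collection of subsets: the maximal number of members
with non-empty intersection. -/
def coverMultiplicity {X : Type*} (𝒰 : Set (Set X)) : ℕ∞ :=
  ⨆ (𝒮 : Set (Set X)) (_ : 𝒮 ⊆ 𝒰) (_ : (⋂₀ 𝒮).Nonempty), 𝒮.encard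

/-- The mesh of a collection of subsets: the supremum of the diameters of its members. -/
def mesh {X : Type*} [PseudoMetricSpace X] (𝒰 : Set (Set X)) : ℝ≥0∞ :=
  ⨆ U ∈ 𝒰, Metric.ediam U

/-- The Lebesgue number of the cover `𝒰` of `X` is at least `L`: every open ball of radius `L`
of the space `X` is contained in a member of `𝒰`. -/
def LebesgueNumberGE {X : Type*} [PseudoMetricSpace X] (𝒰 : Set (Set X)) (L : ℝ) : Prop :=
  ∀ x : X, ∃ U ∈ 𝒰, Metric.ball x L ⊆ U

/-- `asdim X ≤ n`. -/
def AsdimLE (X : Type*) [PseudoMetricSpace X] (n : ℕ) : Prop :=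
  ∀ L : ℝ, 0 < L → ∃ D : ℝ, 0 < D ∧ ∃ 𝒰 : Set (Set X),
    IsCover 𝒰 ∧ coverMultiplicity 𝒰 ≤ (n : ℕ∞) + 1 ∧ LebesgueNumberGE 𝒰 L ∧
      mesh 𝒰 ≤ ENNReal.ofReal D

/-- `X` has nicely `n`-covered spheres with respect to the basepoint `x₀`. The spheres
`{x | dist x x₀ = k * ρ}` carry the metric restricted from `X`, and `𝒰 k` is a collection of
subsets of the `k`-th sphere. -/
def HasNicelyCoveredSpheres {X : Type*} [MetricSpace X] (x₀ : X) (n : ℕ) : Prop :=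
  ∃ ρ : ℝ, 0 < ρ ∧ ∃ 𝒰 : (k : ℕ) → Set (Set (Metric.sphere x₀ (k * ρ))),
    (∀ k, IsCover (𝒰 k)) ∧
    (∃ lam : ℝ, 0 < lam ∧ ∀ k, LebesgueNumberGE (𝒰 k) lam) ∧
    (∃ D : ℝ, ∀ k, mesh (𝒰 k) ≤ ENNReal.ofReal D) ∧
    (∀ k, coverMultiplicity (𝒰 k) ≤ (n : ℕ∞))

/-! ### Geodesic spaces and the CAT(κ) inequality, for κ < 0 -/

/-- `γ`, restricted to `[0, dist p q]`, is a geodesic (an isometric embedding of that interval)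
from `p` to `q`. -/
def IsGeodesic {X : Type*} [MetricSpace X] (γ : ℝ → X) (p q : X) : Prop :=
  γ 0 = p ∧ γ (dist p q) = q ∧
    ∀ s ∈ Set.Icc 0 (dist p q), ∀ t ∈ Set.Icc 0 (dist p q), dist (γ s) (γ t) = |s - t|

/-- Any two points are joined by a geodesic. -/
def IsGeodesicSpace (X : Type*) [MetricSpace X] : Prop :=
  ∀ p q : X, ∃ γ : ℝ → X, IsGeodesic γ p q

/-- A geodesic triangle: three vertices, and for each `i` (modulo `3`) a geodesic from the
`i`-th vertex to the next one. -/
structure GeodesicTriangle (X : Type*) [MetricSpace X] where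
  vertex : Fin 3 → X
  path : Fin 3 → ℝ → X
  isGeodesic : ∀ i, IsGeodesic (path i) (vertex i) (vertex (i + 1))

/-- The `i`-th side of a geodesic triangle, as a set of points. -/
def GeodesicTriangle.side {X : Type*} [MetricSpace X] (T : GeodesicTriangle X) (i : Fin 3) :
    Set X :=
  T.path i '' Set.Icc 0 (dist (T.vertex i) (T.vertex (i + 1)))

/-- The distance of the model plane of constant curvature `κ < 0`: the Poincaré half-plane, whose
Mathlib metric has curvature `-1`, with its distance divided by `√(-κ)`. -/
def modelDist (κ : ℝ) (z w : ℍ) : ℝ :=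
  dist z w / √(-κ)

/-- `v'` are the vertices of a comparison triangle in the model plane for `T`. -/
def GeodesicTriangle.IsComparison {X : Type*} [MetricSpace X] (κ : ℝ) (T : GeodesicTriangle X)
    (v' : Fin 3 → ℍ) : Prop :=
  ∀ i j, modelDist κ (v' i) (v' j) = dist (T.vertex i) (T.vertex j)

/-- `x'` is the comparison point of the point `x` of the `i`-th side of `T`. Its two distances add
up to the length of the `i`-th side of the comparison triangle, so that it lies on that side. -/
def GeodesicTriangle.IsComparisonPoint {X : Type*} [MetricSpace X] (κ : ℝ)
    (T : GeodesicTriangle X) (v' : Fin 3 → ℍ) (i : Fin 3) (x : X) (x' : ℍ) : Prop :=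
  modelDist κ (v' i) x' = dist (T.vertex i) x ∧
    modelDist κ x' (v' (i + 1)) = dist x (T.vertex (i + 1))

/-- The CAT(κ) inequality for a geodesic triangle: distances of points on the triangle are at most
the distances of their comparison points in a comparison triangle. (Comparison triangles exist and
are unique up to isometry, and comparison points exist and are unique, so it does not matter
whether one quantifies over them universally or existentially.) -/
def GeodesicTriangle.SatisfiesCAT {X : Type*} [MetricSpace X] (κ : ℝ)
    (T : GeodesicTriangle X) : Prop :=
  ∃ v' : Fin 3 → ℍ, T.IsComparison κ v' ∧
    ∀ i j, ∀ x ∈ T.side i, ∀ y ∈ T.side j, ∃ x' y' : ℍ,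
      T.IsComparisonPoint κ v' i x x' ∧ T.IsComparisonPoint κ v' j y y' ∧
        dist x y ≤ modelDist κ x' y'

/-- `X` is a CAT(κ)-space, for `κ < 0`: a geodesic space all of whose geodesic triangles satisfy
the CAT(κ) inequality. -/
def IsCATSpace (κ : ℝ) (X : Type*) [MetricSpace X] : Prop :=
  IsGeodesicSpace X ∧ ∀ T : GeodesicTriangle X, T.SatisfiesCAT κ

end

end CATAsdim

/-! In negative curvature, radial projection towards `x₀` contracts exponentially. By hyperbolic
trigonometry and comparison triangles, sets of bounded diameter shrink below any prescribed size
once they are projected over a sufficiently long distance (`IsCATSpace.exists_dist_radial_lt`). Keep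
only the spheres of radius `k * r` with `r` large. A ball of radius `L` far enough above such a
sphere then projects into one member of its cover, and each nonempty member of one cover projects
into a member, its parent, of the cover below.

Cylinders over the members of each cover handle a shell of thickness `r`. Changing covers everywhere
at the same height could give multiplicity `2 * n` there. Instead each cover is refined to `n`
colours with disjoint members within each colour (`exists_colored_cover`), and the colours change
over one at a time, in disjoint windows of heights. Below its window a member is absorbed into its
parent; above, it stands for itself. At each height at most one colour counts twice, so at most `n +
1` sets meet (`encard_switching_le`, `encard_gluedSet_le`). `exists_cover_of_colored_covers` carries
out this gluing. -/

namespace CATAsdim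

/-! ### Hyperbolic trigonometry in the upper half-plane -/

/-- The Lorentzian form in light-cone coordinates vanishes on no non-zero vector orthogonal to a
timelike one. -/
theorem eq_zero_of_lorentz_orthogonal {a b c u v w : ℝ} (hp : a * c - b ^ 2 = 1)
    (horth : (u * c + w * a) / 2 - v * b = 0) (hnull : u * w - v ^ 2 = 0) :
    u = 0 ∧ v = 0 ∧ w = 0 := by
  have hac : a * c ≠ 0 := by nlinarith [sq_nonneg b]
  -- The form is negative definite on the orthogonal complement of a timelike vector; this sum of
  -- squares makes that explicit.
  have h1 : (u * c - w * a) ^ 2 + 4 * v ^ 2 = 0 := by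
    linear_combination (2 * (u * c + w * a) + 4 * v * b) * horth - 4 * v ^ 2 * hp -
      4 * a * c * hnull
  have hv : v = 0 := by nlinarith [sq_nonneg (u * c - w * a), sq_nonneg v]
  have h2 : u * c - w * a = 0 := by nlinarith [sq_nonneg (u * c - w * a), sq_nonneg v]
  subst hv
  have h3 : u * c = 0 := by linarith
  have h4 : w * a = 0 := by linarith
  exact ⟨(mul_eq_zero.1 h3).resolve_right (right_ne_zero_of_mul hac), rfl,
    (mul_eq_zero.1 h4).resolve_right (left_ne_zero_of_mul hac)⟩

/-- The hyperbolic cosine of the distance is the Lorentzian form of the light-cone coordinates. -/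
theorem cosh_dist_eq_lorentz (z w : ℍ) :
    Real.cosh (dist z w) =
      (1 / z.im * ((w.re ^ 2 + w.im ^ 2) / w.im) + (z.re ^ 2 + z.im ^ 2) / z.im * (1 / w.im)) / 2 -
        z.re / z.im * (w.re / w.im) := by
  have hz := z.im_pos.ne'
  have hw := w.im_pos.ne'
  rw [UpperHalfPlane.cosh_dist, Complex.dist_eq, Complex.sq_norm, Complex.normSq_apply]
  simp only [Complex.sub_re, Complex.sub_im, UpperHalfPlane.coe_re, UpperHalfPlane.coe_im]
  field_simp
  ring

open Real in
/-- Stewart's theorem in the hyperbolic plane: for `p` on the segment from `o` to `x`, the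
hyperbolic cosine of the distance to `p` is a combination of those to `o` and `x`. -/
theorem sinh_mul_cosh_dist_of_dist_add {o p x : ℍ} (h : dist o p + dist p x = dist o x) (q : ℍ) :
    sinh (dist o x) * cosh (dist q p) =
      sinh (dist p x) * cosh (dist q o) + sinh (dist o p) * cosh (dist q x) := by
  have hn : ∀ z : ℍ, 1 / z.im * ((z.re ^ 2 + z.im ^ 2) / z.im) - (z.re / z.im) ^ 2 = 1 := by
    intro z
    have hz := z.im_pos.ne'
    field_simp
    ring
  have e1 := cosh_dist_eq_lorentz o p
  have e2 := cosh_dist_eq_lorentz p x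
  have e3 := cosh_dist_eq_lorentz o x
  rw [cosh_dist_eq_lorentz q p, cosh_dist_eq_lorentz q o, cosh_dist_eq_lorentz q x]
  have hs := sinh_add (dist o p) (dist p x)
  have hc := cosh_add (dist o p) (dist p x)
  have q1 := cosh_sq (dist o p)
  have q2 := cosh_sq (dist p x)
  have no := hn o
  have np := hn p
  have nx := hn x
  rw [h] at hs hc
  generalize sinh (dist o x) = S at *
  generalize cosh (dist o x) = C at *
  generalize sinh (dist o p) = s₁ at *
  generalize cosh (dist o p) = c₁ at *
  generalize sinh (dist p x) = s₂ at *
  generalize cosh (dist p x) = c₂ at *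
  generalize 1 / o.im = oa at *
  generalize o.re / o.im = ob at *
  generalize (o.re ^ 2 + o.im ^ 2) / o.im = oc at *
  generalize 1 / p.im = pa at *
  generalize p.re / p.im = pb at *
  generalize (p.re ^ 2 + p.im ^ 2) / p.im = pc at *
  generalize 1 / x.im = xa at *
  generalize x.re / x.im = xb at *
  generalize (x.re ^ 2 + x.im ^ 2) / x.im = xc at *
  -- As vectors on the hyperboloid, `S • p = s₂ • o + s₁ • x`: the difference is orthogonal to `p`
  -- and null, hence zero. Pairing this relation with `q` gives the claim.
  obtain ⟨hu, hv, hw⟩ := eq_zero_of_lorentz_orthogonal (u := S * pa - s₂ * oa - s₁ * xa)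
    (v := S * pb - s₂ * ob - s₁ * xb) (w := S * pc - s₂ * oc - s₁ * xc) np
    (by linear_combination S * np + s₂ * e1 + s₁ * e2 + hs)
    (by
      have h1 : S ^ 2 = s₁ ^ 2 + s₂ ^ 2 + 2 * s₁ * s₂ * C := by
        rw [hs, hc]; linear_combination s₁ ^ 2 * q2 + s₂ ^ 2 * q1
      linear_combination S ^ 2 * np + s₂ ^ 2 * no + s₁ ^ 2 * nx + 2 * S * s₂ * e1 +
        2 * S * s₁ * e2 - 2 * s₁ * s₂ * e3 - h1 + 2 * S * hs)
  linear_combination (1 / 2 * ((q.re ^ 2 + q.im ^ 2) / q.im)) * hu + (1 / q.im / 2) * hw -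
    (q.re / q.im) * hv

open Real in
/-- Two geodesics of the hyperbolic plane issuing from the same point diverge exponentially:
radial projection to a sphere contracts. -/
theorem cosh_dist_sub_one_le_of_dist_add {o x y p q : ℍ} {R r : ℝ} (hr : 0 ≤ r)
    (hp : dist o p = R) (hq : dist o q = R)
    (hpx : dist o p + dist p x = dist o x) (hqy : dist o q + dist q y = dist o y)
    (hx : R + r ≤ dist o x) (hy : R + r ≤ dist o y) :
    cosh (dist p q) - 1 ≤ exp (-(2 * r)) * (cosh (dist x y) - 1) := by
  have hR : 0 ≤ R := hp ▸ dist_nonneg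
  have hexp := exp_pos (-(2 * r))
  have hxy := one_le_cosh (dist x y)
  rcases hR.eq_or_lt with h0 | hR
  · have h1 : o = p := dist_eq_zero.1 (hp.trans h0.symm)
    have h2 : o = q := dist_eq_zero.1 (hq.trans h0.symm)
    rw [← h1, ← h2, dist_self, cosh_zero]
    nlinarith
  have key1 := sinh_mul_cosh_dist_of_dist_add hpx q
  have key2 := sinh_mul_cosh_dist_of_dist_add hqy x
  have hA : 0 < sinh R := sinh_pos_iff.2 hR
  have hstep : ∀ t, R + r ≤ t → exp r * sinh R ≤ sinh t := by
    intro t ht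
    refine le_trans ?_ (sinh_le_sinh.2 ht)
    rw [sinh_add, ← cosh_add_sinh r]
    nlinarith [sinh_lt_cosh R, sinh_nonneg_iff.2 hr]
  have hX := hstep _ hx
  have hY := hstep _ hy
  have hpx' : dist p x = dist o x - R := by linarith
  have hqy' : dist q y = dist o y - R := by linarith
  rw [hpx', dist_comm q o, hq, hp, dist_comm q p, dist_comm q x] at key1
  rw [hqy', dist_comm x o, hq] at key2
  have hab := one_le_cosh (dist o x - dist o y)
  rw [cosh_sub] at hab
  rw [sinh_sub] at key1 key2
  have qR := cosh_sq R
  have qa := cosh_sq (dist o x)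
  have qb := cosh_sq (dist o y)
  have he : exp r * exp r * exp (-(2 * r)) = 1 := by
    rw [← exp_add, ← exp_add]; ring_nf; exact exp_zero
  have hE := exp_pos r
  generalize exp (-(2 * r)) = E' at *
  generalize exp r = E at *
  generalize cosh (dist p q) = P at *
  generalize cosh (dist x y) = Q at *
  generalize cosh (dist x q) = M at *
  generalize sinh (dist o x) = a at *
  generalize cosh (dist o x) = a' at *
  generalize sinh (dist o y) = b at *
  generalize cosh (dist o y) = b' at *
  generalize sinh R = A at *
  generalize cosh R = B at *
  have ha : 0 < a := lt_of_lt_of_le (by positivity) hX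
  have hb : 0 < b := lt_of_lt_of_le (by positivity) hY
  -- By the law of cosines both sides equal `a * b * A ^ 2 * (1 - cos θ)`, with `θ` the angle at
  -- `o`. Applying Stewart's theorem twice avoids introducing the angle.
  have hmain : a * b * (P - 1) = A ^ 2 * (Q - (a' * b' - a * b)) := by
    linear_combination b * key1 + A * key2 + a * b * qR
  have h1 : a * b * (P - 1) ≤ A ^ 2 * (Q - 1) := by
    rw [hmain]; nlinarith [sq_nonneg A]
  have h2 : (E * A) * (E * A) ≤ a * b := by gcongr
  have h3 : A ^ 2 ≤ a * b * E' := by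
    calc A ^ 2 = (E * A) * (E * A) * E' := by linear_combination (-A ^ 2) * he
      _ ≤ _ := by gcongr
  have h4 : a * b * (P - 1) ≤ a * b * (E' * (Q - 1)) := by nlinarith
  exact le_of_mul_le_mul_left h4 (by positivity)

/-! ### Radial projections in CAT(κ)-spaces -/

theorem IsGeodesic.reverse {X : Type*} [MetricSpace X] {γ : ℝ → X} {p q : X}
    (h : IsGeodesic γ p q) : IsGeodesic (fun t => γ (dist p q - t)) q p := by
  obtain ⟨h0, h1, h2⟩ := h
  refine ⟨by simpa using h1, by simpa [dist_comm q p] using h0, fun s hs t ht => ?_⟩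
  rw [dist_comm q p] at hs ht
  rw [h2 _ ⟨by linarith [hs.2], by linarith [hs.1]⟩ _ ⟨by linarith [ht.2], by linarith [ht.1]⟩,
    abs_sub_comm]
  congr 1
  ring

theorem IsGeodesic.dist_left {X : Type*} [MetricSpace X] {γ : ℝ → X} {p q : X}
    (h : IsGeodesic γ p q) {R : ℝ} (hR : 0 ≤ R) (hR' : R ≤ dist p q) : dist p (γ R) = R := by
  have := h.2.2 0 ⟨le_rfl, dist_nonneg⟩ R ⟨hR, hR'⟩
  rw [h.1] at this
  simpa [abs_of_nonneg hR] using this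

theorem IsGeodesic.dist_right {X : Type*} [MetricSpace X] {γ : ℝ → X} {p q : X}
    (h : IsGeodesic γ p q) {R : ℝ} (hR : 0 ≤ R) (hR' : R ≤ dist p q) :
    dist (γ R) q = dist p q - R := by
  have := h.2.2 R ⟨hR, hR'⟩ (dist p q) ⟨dist_nonneg, le_rfl⟩
  rw [h.2.1] at this
  rw [this, abs_sub_comm, abs_of_nonneg (by linarith)]

theorem IsGeodesic.restrict {X : Type*} [MetricSpace X] {γ : ℝ → X} {p q : X}
    (h : IsGeodesic γ p q) {R : ℝ} (hR : 0 ≤ R) (hR' : R ≤ dist p q) : IsGeodesic γ p (γ R) := by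
  refine ⟨h.1, by rw [h.dist_left hR hR'], fun s hs t ht => ?_⟩
  rw [h.dist_left hR hR'] at hs ht
  exact h.2.2 s ⟨hs.1, hs.2.trans hR'⟩ t ⟨ht.1, ht.2.trans hR'⟩

/-- Geodesics issuing from the same point of a CAT(κ)-space diverge exponentially. -/
theorem IsCATSpace.cosh_dist_sub_one_le {κ : ℝ} (hκ : κ < 0) {X : Type*} [MetricSpace X]
    (hX : IsCATSpace κ X) {o x y : X} {γ γ' : ℝ → X} (hγ : IsGeodesic γ o x)
    (hγ' : IsGeodesic γ' o y) {R r : ℝ} (hR : 0 ≤ R) (hr : 0 ≤ r) (hx : R + r ≤ dist o x)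
    (hy : R + r ≤ dist o y) :
    Real.cosh (dist (γ R) (γ' R) * √(-κ)) - 1 ≤
      Real.exp (-(2 * (r * √(-κ)))) * (Real.cosh (dist x y * √(-κ)) - 1) := by
  obtain ⟨σ, hσ⟩ := hX.1 x y
  let T : GeodesicTriangle X :=
    { vertex := ![o, x, y]
      path := ![γ, σ, fun t => γ' (dist o y - t)]
      isGeodesic := by
        intro i
        fin_cases i
        · exact hγ
        · exact hσ
        · exact hγ'.reverse }
  obtain ⟨v, hv, hcat⟩ := hX.2 T
  have hRx : R ≤ dist o x := by linarith
  have hRy : R ≤ dist o y := by linarith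
  have hK : 0 < √(-κ) := Real.sqrt_pos.2 (by linarith)
  -- Side `2` runs from `y` back to `o`, so `γ' R` sits at parameter `dist o y - R`.
  obtain ⟨p, q, hp, hq, hpq⟩ := hcat 0 2 (γ R) ⟨R, ⟨hR, hRx⟩, rfl⟩ (γ' R)
    ⟨dist o y - R, ⟨by linarith, by
      change dist o y - R ≤ dist y o
      rw [dist_comm y o]; linarith⟩, by
      change γ' (dist o y - (dist o y - R)) = γ' R
      rw [sub_sub_cancel]⟩
  have hox : dist (v 0) (v 1) = dist o x * √(-κ) := (div_eq_iff hK.ne').1 (hv 0 1)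
  have hoy : dist (v 0) (v 2) = dist o y * √(-κ) := (div_eq_iff hK.ne').1 (hv 0 2)
  have hxy : dist (v 1) (v 2) = dist x y * √(-κ) := (div_eq_iff hK.ne').1 (hv 1 2)
  have hop : dist (v 0) p = R * √(-κ) := by
    rw [← hγ.dist_left hR hRx]; exact (div_eq_iff hK.ne').1 hp.1
  have hpx : dist p (v 1) = (dist o x - R) * √(-κ) := by
    rw [← hγ.dist_right hR hRx]; exact (div_eq_iff hK.ne').1 hp.2
  have hoq : dist (v 0) q = R * √(-κ) := by
    rw [← hγ'.dist_left hR hRy, dist_comm, dist_comm o]; exact (div_eq_iff hK.ne').1 hq.2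
  have hqy : dist q (v 2) = (dist o y - R) * √(-κ) := by
    rw [← hγ'.dist_right hR hRy, dist_comm, dist_comm (γ' R)]; exact (div_eq_iff hK.ne').1 hq.1
  have hle : dist (γ R) (γ' R) * √(-κ) ≤ dist p q := (le_div_iff₀ hK).1 hpq
  have hmain := cosh_dist_sub_one_le_of_dist_add (o := v 0) (x := v 1) (y := v 2)
    (r := r * √(-κ)) (by positivity) hop hoq (by rw [hop, hpx, hox]; ring)
    (by rw [hoq, hqy, hoy]; ring) (by rw [hox, ← add_mul]; gcongr) (by rw [hoy, ← add_mul]; gcongr)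
  rw [hxy] at hmain
  refine le_trans ?_ hmain
  gcongr
  rw [Real.cosh_le_cosh, abs_of_nonneg (by positivity), abs_of_nonneg dist_nonneg]
  exact hle

/-- Geodesics in a CAT(κ)-space are determined by their endpoints. -/
theorem IsCATSpace.geodesic_unique {κ : ℝ} (hκ : κ < 0) {X : Type*} [MetricSpace X]
    (hX : IsCATSpace κ X) {o x : X} {γ γ' : ℝ → X} (hγ : IsGeodesic γ o x)
    (hγ' : IsGeodesic γ' o x) {R : ℝ} (hR : 0 ≤ R) (hR' : R ≤ dist o x) : γ R = γ' R := by
  have h := hX.cosh_dist_sub_one_le hκ hγ hγ' hR le_rfl (by simpa using hR') (by simpa using hR')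
  rw [dist_self, zero_mul, Real.cosh_zero, sub_self, mul_zero] at h
  have hK : 0 < √(-κ) := Real.sqrt_pos.2 (by linarith)
  have h0 : dist (γ R) (γ' R) * √(-κ) = 0 := by
    by_contra hne
    linarith [Real.one_lt_cosh.2 hne]
  exact dist_eq_zero.1 ((mul_eq_zero.1 h0).resolve_right hK.ne')

/-- The point at distance `R` from `o` on a chosen geodesic from `o` to `x`. -/
noncomputable def IsGeodesicSpace.radial {X : Type*} [MetricSpace X] (hX : IsGeodesicSpace X)
    (o : X) (R : ℝ) (x : X) : X :=
  (hX o x).choose R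

theorem IsGeodesicSpace.dist_radial_left {X : Type*} [MetricSpace X] (hX : IsGeodesicSpace X)
    {o x : X} {R : ℝ} (hR : 0 ≤ R) (hx : R ≤ dist o x) : dist o (hX.radial o R x) = R :=
  (hX o x).choose_spec.dist_left hR hx

theorem IsGeodesicSpace.dist_radial_right {X : Type*} [MetricSpace X] (hX : IsGeodesicSpace X)
    {o x : X} {R : ℝ} (hR : 0 ≤ R) (hx : R ≤ dist o x) :
    dist (hX.radial o R x) x = dist o x - R :=
  (hX o x).choose_spec.dist_right hR hx

/-- The two projections use independently chosen geodesics, so their compatibility rests on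
uniqueness of geodesics. -/
theorem IsCATSpace.radial_radial {κ : ℝ} (hκ : κ < 0) {X : Type*} [MetricSpace X]
    (hX : IsCATSpace κ X) {o x : X} {R R' : ℝ} (hR : 0 ≤ R) (hRR' : R ≤ R')
    (hx : R' ≤ dist o x) : hX.1.radial o R (hX.1.radial o R' x) = hX.1.radial o R x := by
  have hR' := hR.trans hRR'
  refine hX.geodesic_unique hκ (hX.1 _ _).choose_spec
    ((hX.1 o x).choose_spec.restrict hR' hx) hR ?_
  exact hRR'.trans_eq (hX.1.dist_radial_left hR' hx).symm

/-- Radial projection along a sufficiently long distance contracts bounded distances below any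
given bound. -/
theorem IsCATSpace.exists_dist_radial_lt {κ : ℝ} (hκ : κ < 0) {X : Type*} [MetricSpace X]
    (hX : IsCATSpace κ X) (o : X) (C : ℝ) {ε : ℝ} (hε : 0 < ε) :
    ∃ r₀ : ℝ, 0 ≤ r₀ ∧ ∀ R x y, 0 ≤ R → dist x y ≤ C → R + r₀ ≤ dist o x → R + r₀ ≤ dist o y →
      dist (hX.1.radial o R x) (hX.1.radial o R y) < ε := by
  have hK : 0 < √(-κ) := Real.sqrt_pos.2 (by linarith)
  have hε' : 0 < Real.cosh (ε * √(-κ)) - 1 := by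
    have : ε * √(-κ) ≠ 0 := by positivity
    linarith [Real.one_lt_cosh.2 this]
  have hlim : Filter.Tendsto
      (fun r : ℝ => Real.exp (-(2 * (r * √(-κ)))) * (Real.cosh (C * √(-κ)) - 1))
      Filter.atTop (nhds (0 * (Real.cosh (C * √(-κ)) - 1))) := by
    refine Filter.Tendsto.mul_const _ (Real.tendsto_exp_neg_atTop_nhds_zero.comp ?_)
    exact (Filter.tendsto_id.atTop_mul_const hK).const_mul_atTop two_pos
  rw [zero_mul] at hlim
  obtain ⟨r₀, hr₀, hr⟩ := ((Filter.eventually_ge_atTop (0 : ℝ)).and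
    (hlim.eventually (gt_mem_nhds hε'))).exists
  refine ⟨r₀, hr₀, fun R x y hR hxy hx hy => ?_⟩
  have h := hX.cosh_dist_sub_one_le hκ (hX.1 o x).choose_spec (hX.1 o y).choose_spec hR hr₀ hx hy
  have h2 : Real.cosh (dist x y * √(-κ)) ≤ Real.cosh (C * √(-κ)) := by
    rw [Real.cosh_le_cosh, abs_of_nonneg (by positivity)]
    exact le_trans (by gcongr) (le_abs_self _)
  have h3 : Real.cosh (dist (hX.1.radial o R x) (hX.1.radial o R y) * √(-κ)) <
      Real.cosh (ε * √(-κ)) := by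
    have := mul_le_mul_of_nonneg_left (sub_le_sub_right h2 1)
      (Real.exp_pos (-(2 * (r₀ * √(-κ))))).le
    unfold IsGeodesicSpace.radial
    linarith
  rw [Real.cosh_lt_cosh, abs_of_nonneg (by positivity), abs_of_nonneg (by positivity)] at h3
  exact lt_of_mul_lt_mul_right h3 hK.le

/-! ### Coloured covers -/

theorem encard_le_coverMultiplicity {X : Type*} {𝒰 𝒮 : Set (Set X)} (h : 𝒮 ⊆ 𝒰)
    (hne : (⋂₀ 𝒮).Nonempty) : 𝒮.encard ≤ coverMultiplicity 𝒰 :=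
  le_iSup_of_le 𝒮 (le_iSup_of_le h (le_iSup_of_le hne le_rfl))

/-- A monotone sequence of sets whose cardinalities lie between `1` and `n` is stationary at one of
the first `n` steps. -/
theorem exists_eq_succ_of_encard_le {α : Type*} {n : ℕ} (N : ℕ → Set α) (hmono : Monotone N)
    (h0 : (N 0).Nonempty) (hn : (N n).encard ≤ n) : ∃ j < n, N j = N (j + 1) := by
  by_contra! hcon
  have key : ∀ j ≤ n, ((j + 1 : ℕ) : ℕ∞) ≤ (N j).encard := by
    intro j
    induction j with
    | zero => intro _; simpa [Set.one_le_encard_iff_nonempty] using h0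
    | succ j ih =>
      intro hj
      have hfin : (N j).Finite := by
        refine Set.Finite.subset (Set.finite_of_encard_le_coe hn) (hmono (by omega))
      have hlt := hfin.encard_lt_encard
        ((hmono (Nat.le_succ j)).ssubset_of_ne (hcon j (by omega)))
      have := ih (by omega)
      rw [Nat.cast_add, Nat.cast_one]
      exact Order.add_one_le_of_lt (this.trans_lt hlt)
  have := (key n le_rfl).trans hn
  rw [Nat.cast_le] at this
  omega

/-- A cover of multiplicity at most `n` with positive Lebesgue number has a refinement by `n`
families of pairwise disjoint sets, still with positive Lebesgue number. -/
theorem exists_colored_cover {Y : Type*} [PseudoMetricSpace Y] {𝒰 : Set (Set Y)} {n : ℕ}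
    {lam D : ℝ} (hlam : 0 < lam) (hD : 0 ≤ D) (hL : LebesgueNumberGE 𝒰 lam)
    (hmesh : mesh 𝒰 ≤ ENNReal.ofReal D) (hmult : coverMultiplicity 𝒰 ≤ n) :
    ∃ W : Fin n → Set (Set Y),
      (∀ c, ∀ V ∈ W c, ∀ V' ∈ W c, ∀ z ∈ V, z ∈ V' → V = V') ∧
      (∀ y, ∃ c, ∃ V ∈ W c, Metric.ball y (lam / (2 * (n + 1))) ⊆ V) ∧
      (∀ c, ∀ V ∈ W c, ∀ z ∈ V, ∀ w ∈ V, dist z w ≤ D) := by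
  let N : ℝ → Y → Set (Set Y) := fun t z => {V ∈ 𝒰 | Metric.ball z t ⊆ V}
  have hanti : ∀ z s t, s ≤ t → N t z ⊆ N s z := fun z s t hst V hV =>
    ⟨hV.1, (Metric.ball_subset_ball hst).trans hV.2⟩
  have hshift : ∀ z w s t, dist z w + s ≤ t → N t z ⊆ N s w := fun z w s t hst V hV =>
    ⟨hV.1, (Metric.ball_subset_ball' (by linarith [dist_comm z w])).trans hV.2⟩
  have hcard : ∀ z t, 0 < t → (N t z).encard ≤ n := fun z t ht =>
    (encard_le_coverMultiplicity (fun V hV => hV.1)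
      ⟨z, fun V hV => hV.2 (Metric.mem_ball_self ht)⟩).trans hmult
  -- `P σ` plays the role of the star of the barycentre of the simplex `σ` in the barycentric
  -- subdivision of the nerve; its colour is the dimension of `σ`. For fixed `z` the sets `N t z`
  -- form a chain, so two of equal finite size coincide, which makes each colour disjoint.
  let P : Set (Set Y) → Set Y := fun σ => {z | ∃ t, 0 < t ∧ N t z = σ}
  refine ⟨fun c => {V | ∃ σ ⊆ 𝒰, σ.encard = ((c : ℕ) + 1 : ℕ) ∧ V = P σ}, ?_, ?_, ?_⟩
  · rintro c _ ⟨σ, -, hσ, rfl⟩ _ ⟨σ', -, hσ', rfl⟩ z ⟨t, ht, hz⟩ ⟨t', ht', hz'⟩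
    congr 1
    rcases le_total t t' with h | h
    · have := hanti z _ _ h
      rw [hz, hz'] at this
      exact ((Set.finite_of_encard_eq_coe hσ').eq_of_subset_of_encard_le this
        (by rw [hσ, hσ'])).symm
    · have := hanti z _ _ h
      rw [hz, hz'] at this
      exact (Set.finite_of_encard_eq_coe hσ).eq_of_subset_of_encard_le this (by rw [hσ, hσ'])
  · intro y
    set e : ℝ := lam / (2 * (n + 1)) with he
    have hepos : 0 < e := by positivity
    have hlam' : lam = 2 * (n + 1) * e := by rw [he]; field_simp
    -- The `n + 1` scales `lam = 2 * (n + 1) * e, ..., 2 * e` give an increasing chain of sets with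
    -- between `1` and `n` elements, so two consecutive ones agree.
    obtain ⟨j, hj, hjeq⟩ := exists_eq_succ_of_encard_le (n := n)
      (fun j : ℕ => N (2 * ((n : ℝ) + 1 - j) * e) y)
      (fun i j hij => hanti y _ _ (by
        have : (i : ℝ) ≤ j := by exact_mod_cast hij
        gcongr))
      (by
        obtain ⟨V, hV, hb⟩ := hL y
        exact ⟨V, hV, by simpa [← hlam'] using hb⟩)
      (hcard _ _ (by simp; exact hepos))
    have hjn : (j : ℝ) + 1 ≤ n := by exact_mod_cast hj
    push_cast at hjeq
    set σ := N (2 * ((n : ℝ) + 1 - j) * e) y with hσ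
    have hpos : 0 < 2 * ((n : ℝ) + 1 - j) * e := by
      have : 0 < (n : ℝ) + 1 - j := by linarith
      positivity
    have hne : σ.Nonempty := by
      obtain ⟨V, hV, hb⟩ := hL y
      refine ⟨V, hV, (Metric.ball_subset_ball ?_).trans hb⟩
      rw [hlam']
      gcongr
      linarith [(Nat.cast_nonneg j : (0 : ℝ) ≤ j)]
    have hc := hcard y _ hpos
    rw [← hσ] at hc
    obtain ⟨m, hm⟩ := ENat.ne_top_iff_exists.1 (ne_top_of_le_ne_top (ENat.natCast_ne_top n) hc)
    rw [← hm, Nat.cast_le] at hc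
    have hm1 : 1 ≤ m := by
      have := Set.one_le_encard_iff_nonempty.2 hne
      rw [← hm] at this
      exact_mod_cast this
    refine ⟨⟨m - 1, by omega⟩, _, ⟨σ, fun V hV => hV.1, ?_, rfl⟩, ?_⟩
    · rw [← hm]
      congr 1
      simp only
      omega
    · intro z hz
      rw [Metric.mem_ball] at hz
      -- At the midpoint of the two agreeing scales, moving from `y` to `z` costs less than `e`, so
      -- `N` at `z` is squeezed between two copies of `σ`.
      refine ⟨(2 * ((n : ℝ) + 1 - j) - 1) * e, ?_, Set.Subset.antisymm ?_ ?_⟩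
      · have : 0 < 2 * ((n : ℝ) + 1 - j) - 1 := by linarith
        positivity
      · rw [hjeq]
        exact hshift _ _ _ _ (by linarith)
      · exact hshift _ _ _ _ (by rw [dist_comm]; linarith)
  · rintro c _ ⟨σ, hσ, hcσ, rfl⟩ z ⟨t, ht, hz⟩ w ⟨t', ht', hw⟩
    obtain ⟨V, hV⟩ : σ.Nonempty := by
      rw [← Set.one_le_encard_iff_nonempty, hcσ]
      exact_mod_cast Nat.le_add_left 1 _
    have hzV : z ∈ V := by
      rw [← hz] at hV
      exact hV.2 (Metric.mem_ball_self ht)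
    have hwV : w ∈ V := by
      rw [← hw] at hV
      exact hV.2 (Metric.mem_ball_self ht')
    have h : edist z w ≤ ENNReal.ofReal D :=
      (Metric.edist_le_ediam_of_mem hzV hwV).trans
        ((le_iSup₂_of_le V (hσ hV) le_rfl).trans hmesh)
    rwa [edist_dist, ENNReal.ofReal_le_ofReal_iff hD] at h

/-! ### Gluing coloured covers of spheres along radial projections -/

theorem exists_nat_mul_lt_le {r u : ℝ} (hr : 0 < r) (hu : 0 < u) :
    ∃ k : ℕ, k * r < u ∧ u ≤ (k + 1) * r := by
  have hpos : 0 < ⌈u / r⌉₊ := Nat.ceil_pos.2 (div_pos hu hr)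
  obtain ⟨k, hk⟩ : ∃ k, ⌈u / r⌉₊ = k + 1 := ⟨_, (Nat.succ_pred_eq_of_pos hpos).symm⟩
  refine ⟨k, ?_, ?_⟩
  · rw [← lt_div_iff₀ hr, ← Nat.lt_ceil]
    omega
  · have := Nat.le_ceil (u / r)
    rw [hk, div_le_iff₀ hr] at this
    exact_mod_cast this

/-- The height at which the members of colour `c` of the `k`-th cover take over from the
`(k - 1)`-st cover. -/
def switchHeight (r L : ℝ) (k c : ℕ) : ℝ :=
  if k = 0 then 0 else (k + 1) * r + (c + 1) * (2 * L)

/-- The member of the glued cover obtained from the member `V` of colour `c` of the `k`-th cover: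
it starts at the switching height of its colour and, above the `k`-th zone, persists along the
members of the next cover that refine it, up to their own switching heights. -/
def gluedSet {X : Type*} {n : ℕ} (f : X → ℝ) (π : ℕ → X → X) (r L : ℝ)
    (W : ℕ → Fin n → Set (Set X)) (φ : ℕ → Set X → Fin n × Set X) (k : ℕ) (c : Fin n)
    (V : Set X) : Set X :=
  {x | π k x ∈ V ∧ switchHeight r L k c - L < f x ∧
    (f x ≤ (k + 2) * r + L ∨ ∃ c', ∃ V' ∈ W (k + 1) c', φ k V' = (c, V) ∧ π (k + 1) x ∈ V' ∧
      f x < switchHeight r L (k + 1) c' + L)}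

section Glue

variable {X : Type*} {n : ℕ} {f : X → ℝ} {π : ℕ → X → X} {r L D : ℝ}
  {W : ℕ → Fin n → Set (Set X)} {φ : ℕ → Set X → Fin n × Set X}

theorem switchHeight_succ (r L : ℝ) (k c : ℕ) :
    switchHeight r L (k + 1) c = (k + 2) * r + (c + 1) * (2 * L) := by
  rw [switchHeight, if_neg k.succ_ne_zero]
  push_cast
  ring

theorem switchHeight_succ_add_le (hL : 0 < L) (hr : (2 * n + 3) * L ≤ r) (k : ℕ) (c : Fin n) :
    switchHeight r L (k + 1) c + L ≤ (k + 3) * r := by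
  have hc : ((c : ℕ) : ℝ) + 1 ≤ n := by exact_mod_cast c.2
  rw [switchHeight_succ]
  nlinarith

theorem switchHeight_le (hL : 0 < L) (hr : (2 * n + 3) * L ≤ r) (k : ℕ) (c : Fin n) :
    switchHeight r L k c ≤ (k + 2) * r := by
  have hr0 : 0 ≤ r := le_trans (by positivity) hr
  cases k with
  | zero => simp [switchHeight, hr0]
  | succ k =>
    have := switchHeight_succ_add_le hL hr k c
    push_cast
    linarith

/-- With `le_of_mem_gluedSet`, this confines each level to a band of heights, so that only two
consecutive levels can meet at a point. -/
theorem lt_of_mem_gluedSet_succ (hL : 0 < L) {k : ℕ} {c : Fin n} {V : Set X} {x : X}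
    (hx : x ∈ gluedSet f π r L W φ (k + 1) c V) : (k + 2) * r + L < f x := by
  have h := hx.2.1
  rw [switchHeight_succ] at h
  nlinarith [(Nat.cast_nonneg (c : ℕ) : (0 : ℝ) ≤ (c : ℕ))]

theorem le_of_mem_gluedSet (hL : 0 < L) (hr : (2 * n + 3) * L ≤ r) {k : ℕ} {c : Fin n} {V : Set X}
    {x : X} (hx : x ∈ gluedSet f π r L W φ k c V) : f x ≤ (k + 3) * r := by
  rcases hx.2.2 with h | ⟨c', V', -, -, -, h⟩
  · have : L ≤ r := le_trans (by nlinarith [(Nat.cast_nonneg n : (0 : ℝ) ≤ n)]) hr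
    linarith
  · linarith [switchHeight_succ_add_le hL hr k c']

/-- At most one colour is switching at any given height. -/
theorem encard_switching_le (hL : 0 < L) (k : ℕ) (t : ℝ) :
    {c : Fin n | switchHeight r L (k + 1) c - L < t}.encard +
      {c : Fin n | t < switchHeight r L (k + 1) c + L}.encard ≤ (n : ℕ∞) + 1 := by
  rw [← Set.encard_union_add_encard_inter]
  gcongr
  · refine (Set.encard_le_encard (Set.subset_univ _)).trans ?_
    simp
  -- A colour in both sets has its switching height within `L` of `t`, and these heights are `2 * L`
  -- apart.
  · rw [Set.encard_le_one_iff]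
    rintro a b ⟨ha, ha'⟩ ⟨hb, hb'⟩
    simp only [Set.mem_ofPred_eq, switchHeight_succ] at ha ha' hb hb'
    have h1 : (a : ℕ) < (b : ℕ) + 1 := by
      have : ((a : ℕ) : ℝ) < (b : ℕ) + 1 := by nlinarith
      exact_mod_cast this
    have h2 : (b : ℕ) < (a : ℕ) + 1 := by
      have : ((b : ℕ) : ℝ) < (a : ℕ) + 1 := by nlinarith
      exact_mod_cast this
    exact Fin.ext (by omega)

/-- At most `n + 1` members of the glued cover meet at a point. -/
theorem encard_gluedSet_le (hL : 0 < L) (hr : (2 * n + 3) * L ≤ r)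
    (hdisj : ∀ k c, ∀ V ∈ W k c, ∀ V' ∈ W k c, ∀ z ∈ V, z ∈ V' → V = V') (x : X) :
    {E | ∃ k c, ∃ V ∈ W k c, E = gluedSet f π r L W φ k c V ∧ x ∈ E}.encard ≤ (n : ℕ∞) + 1 := by
  have hr0 : 0 < r := lt_of_lt_of_le (by positivity) hr
  classical
  let v : ℕ → Fin n → Set X := fun k c =>
    if h : ∃ V ∈ W k c, π k x ∈ V then h.choose else ∅
  have hv : ∀ k c, ∀ V ∈ W k c, π k x ∈ V → V = v k c := by
    intro k c V hV hx
    have h : ∃ V ∈ W k c, π k x ∈ V := ⟨V, hV, hx⟩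
    simp only [v, dif_pos h]
    exact hdisj k c V hV _ h.choose_spec.1 _ hx h.choose_spec.2
  have hlow : ∀ k j : ℕ, ∀ c V, x ∈ gluedSet f π r L W φ j c V → f x ≤ (k + 2) * r + L →
      j ≤ k := by
    intro k j c V hx hk
    by_contra! hkj
    obtain ⟨i, rfl⟩ : ∃ i, j = i + 1 := ⟨j - 1, by omega⟩
    have h := lt_of_mem_gluedSet_succ hL hx
    have hki : (k : ℝ) ≤ i := by exact_mod_cast (by omega : k ≤ i)
    nlinarith
  by_cases hfx : f x ≤ 2 * r + L
  · have hsub : {E | ∃ k c, ∃ V ∈ W k c, E = gluedSet f π r L W φ k c V ∧ x ∈ E} ⊆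
        (fun c => gluedSet f π r L W φ 0 c (v 0 c)) '' Set.univ := by
      rintro _ ⟨k, c, V, hV, rfl, hx⟩
      obtain rfl : k = 0 := by
        have := hlow 0 k c V hx (by simpa using hfx)
        omega
      exact ⟨c, trivial, by simp only [← hv 0 c V hV hx.1]⟩
    refine (Set.encard_le_encard hsub).trans ((Set.encard_image_le _ _).trans ?_)
    simp
  -- The shell is shifted up by `L`: above `(k + 2) * r + L` a set of level `k` survives only along
  -- its children, so it is determined by the colour of a child over `x` that has not finished
  -- switching.
  · obtain ⟨k, hk1, hk2⟩ := exists_nat_mul_lt_le hr0 (u := f x - (2 * r + L)) (by linarith)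
    have hsub : {E | ∃ k c, ∃ V ∈ W k c, E = gluedSet f π r L W φ k c V ∧ x ∈ E} ⊆
        (fun c => gluedSet f π r L W φ (k + 1) c (v (k + 1) c)) ''
            {c : Fin n | switchHeight r L (k + 1) c - L < f x} ∪
          (fun c => gluedSet f π r L W φ k (φ k (v (k + 1) c)).1 (φ k (v (k + 1) c)).2) ''
            {c : Fin n | f x < switchHeight r L (k + 1) c + L} := by
      rintro _ ⟨j, c, V, hV, rfl, hx⟩
      have hj1 : j ≤ k + 1 := hlow (k + 1) j c V hx (by push_cast; linarith)
      have hj2 : k ≤ j := by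
        by_contra! hjk
        have hle := le_of_mem_gluedSet hL hr hx
        have : (j : ℝ) + 1 ≤ k := by exact_mod_cast hjk
        nlinarith
      obtain rfl | rfl : j = k + 1 ∨ j = k := by omega
      · exact Or.inl ⟨c, hx.2.1, by simp only [← hv _ c V hV hx.1]⟩
      · rcases hx.2.2 with h | ⟨c', V', hV', hφ, hxV', h⟩
        · linarith
        · refine Or.inr ⟨c', h, ?_⟩
          simp only [← hv _ c' V' hV' hxV', hφ]
    refine (Set.encard_le_encard hsub).trans ((Set.encard_union_le _ _).trans ?_)
    exact (add_le_add (Set.encard_image_le _ _) (Set.encard_image_le _ _)).trans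
      (encard_switching_le hL k (f x))

/-- Gluing coloured covers, each of whose members is radially projected into a member of the
previous cover, to a cover of the whole space. -/
theorem exists_cover_of_colored_covers [MetricSpace X] (hL : 0 < L) (hr : (2 * n + 3) * L ≤ r)
    (hf0 : ∀ x, 0 ≤ f x) (hf : ∀ x y, |f x - f y| ≤ dist x y)
    (hπ : ∀ (k : ℕ) x, k * r ≤ f x → dist x (π k x) ≤ f x - k * r)
    (hππ : ∀ (k : ℕ) x, (k + 1) * r ≤ f x → π k (π (k + 1) x) = π k x)
    (hdisj : ∀ k c, ∀ V ∈ W k c, ∀ V' ∈ W k c, ∀ z ∈ V, z ∈ V' → V = V')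
    (hdiam : ∀ k c, ∀ V ∈ W k c, ∀ z ∈ V, ∀ w ∈ V, dist z w ≤ D)
    (hW0 : ∃ c, ∃ V ∈ W 0 c, ∀ y, π 0 y ∈ V)
    (hW : ∀ (k : ℕ) x, (k + 2) * r < f x →
      ∃ c, ∃ V ∈ W (k + 1) c, ∀ y ∈ Metric.ball x L, π (k + 1) y ∈ V)
    (href : ∀ k c, ∀ V ∈ W (k + 1) c, V.Nonempty →
      ∃ c', ∃ V' ∈ W k c', ∀ z ∈ V, π k z ∈ V') :
    ∃ D' : ℝ, 0 < D' ∧ ∃ 𝒰 : Set (Set X), IsCover 𝒰 ∧ coverMultiplicity 𝒰 ≤ (n : ℕ∞) + 1 ∧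
      LebesgueNumberGE 𝒰 L ∧ mesh 𝒰 ≤ ENNReal.ofReal D' := by
  have hr0 : 0 < r := lt_of_lt_of_le (by positivity) hr
  have hLr : L ≤ r := le_trans (by nlinarith [(Nat.cast_nonneg n : (0 : ℝ) ≤ n)]) hr
  have hfball : ∀ x y, y ∈ Metric.ball x L → f y < f x + L ∧ f x - L < f y := by
    intro x y hy
    rw [Metric.mem_ball] at hy
    have := abs_le.1 (hf y x)
    constructor <;> linarith
  have hφ : ∀ (k : ℕ) (V : Set X), ∃ p : Fin n × Set X, ∀ c, V ∈ W (k + 1) c → V.Nonempty →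
      p.2 ∈ W k p.1 ∧ ∀ z ∈ V, π k z ∈ p.2 := by
    intro k V
    by_cases h : ∃ c, V ∈ W (k + 1) c ∧ V.Nonempty
    · obtain ⟨c, hV, hne⟩ := h
      obtain ⟨c', V', hV', hz⟩ := href k c V hV hne
      exact ⟨(c', V'), fun _ _ _ => ⟨hV', hz⟩⟩
    · obtain ⟨c, V', -⟩ := hW0
      -- An arbitrary value; `hW0` serves here to supply a colour.
      exact ⟨(c, V'), fun c hV hne => absurd ⟨c, hV, hne⟩ h⟩
  choose φ hφ using hφ
  let 𝒰 : Set (Set X) := {E | ∃ k c, ∃ V ∈ W k c, E = gluedSet f π r L W φ k c V}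
  have hleb : LebesgueNumberGE 𝒰 L := by
    intro x
    by_cases hfx : f x ≤ 2 * r
    · obtain ⟨c, V, hV, hy⟩ := hW0
      refine ⟨_, ⟨0, c, V, hV, rfl⟩, fun y hyx => ⟨hy y, ?_, Or.inl ?_⟩⟩
      · simp only [switchHeight, if_true]
        linarith [hf0 y]
      · have := (hfball x y hyx).1
        push_cast
        linarith
    · obtain ⟨k, hk1, hk2⟩ := exists_nat_mul_lt_le hr0 (u := f x - 2 * r) (by linarith)
      obtain ⟨c, V, hV, hy⟩ := hW k x (by linarith)
      -- If the colour of `V` has switched, `V` itself captures the ball; otherwise its parent does,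
      -- through the child `V`.
      by_cases hsw : switchHeight r L (k + 1) c ≤ f x
      · refine ⟨_, ⟨k + 1, c, V, hV, rfl⟩, fun y hyx => ⟨hy y hyx, ?_, Or.inl ?_⟩⟩
        · linarith [(hfball x y hyx).2]
        · have := (hfball x y hyx).1
          push_cast
          linarith
      · obtain ⟨h1, h2⟩ := hφ k V c hV ⟨_, hy x (Metric.mem_ball_self hL)⟩
        refine ⟨_, ⟨k, _, _, h1, rfl⟩, fun y hyx => ⟨?_, ?_, Or.inr
          ⟨c, V, hV, rfl, hy y hyx, by linarith [(hfball x y hyx).1]⟩⟩⟩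
        · have := h2 _ (hy y hyx)
          rwa [hππ k y (by linarith [(hfball x y hyx).2])] at this
        · linarith [(hfball x y hyx).2, switchHeight_le hL hr k (φ k V).1]
  have hlower : ∀ k c V x, x ∈ gluedSet f π r L W φ k c V → (k : ℝ) * r ≤ f x := by
    intro k c V x hx
    cases k with
    | zero => simpa using hf0 x
    | succ k =>
      have := lt_of_mem_gluedSet_succ hL hx
      push_cast
      linarith
  -- Points of a level-`k` set lie at most `3 * r` above their projections, which are within `D` of
  -- each other.
  refine ⟨6 * r + |D|, by positivity, 𝒰, ?_, ?_, hleb, ?_⟩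
  · refine Set.eq_univ_of_forall fun x => ?_
    obtain ⟨E, hE, hx⟩ := hleb x
    exact ⟨E, hE, hx (Metric.mem_ball_self hL)⟩
  · refine iSup_le fun 𝒮 => iSup_le fun h𝒮 => iSup_le fun ⟨x, hx⟩ => ?_
    refine le_trans (Set.encard_le_encard fun E hE => ?_)
      (encard_gluedSet_le (f := f) (π := π) (φ := φ) hL hr hdisj x)
    obtain ⟨k, c, V, hV, hEV⟩ := h𝒮 hE
    exact ⟨k, c, V, hV, hEV, hx E hE⟩
  · refine iSup₂_le ?_
    rintro _ ⟨k, c, V, hV, rfl⟩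
    refine Metric.ediam_le fun x hx y hy => ?_
    rw [edist_dist]
    refine ENNReal.ofReal_le_ofReal ?_
    have hx1 := hπ k x (hlower k c V x hx)
    have hy1 := hπ k y (hlower k c V y hy)
    have hx2 := le_of_mem_gluedSet hL hr hx
    have hy2 := le_of_mem_gluedSet hL hr hy
    have hxy := hdiam k c V hV _ hx.1 _ hy.1
    have h4 := dist_triangle4 x (π k x) (π k y) y
    rw [dist_comm (π k y) y] at h4
    linarith [le_abs_self D]

end Glue

/-- Coloured covers of a sequence of spheres in a space with nicely covered spheres, as families of
subsets of the whole space. -/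
theorem HasNicelyCoveredSpheres.exists_colored_covers {X : Type*} [MetricSpace X] {x₀ : X} {n : ℕ}
    (h : HasNicelyCoveredSpheres x₀ n) :
    ∃ ρ δ D : ℝ, 0 < ρ ∧ 0 < δ ∧ ∃ W : ℕ → Fin n → Set (Set X),
      (∀ k c, ∀ V ∈ W k c, ∀ V' ∈ W k c, ∀ z ∈ V, z ∈ V' → V = V') ∧
      (∀ (k : ℕ) y, dist y x₀ = k * ρ → ∃ c, ∃ V ∈ W k c,
        ∀ z, dist z x₀ = k * ρ → dist z y < δ → z ∈ V) ∧
      (∀ k c, ∀ V ∈ W k c, ∀ z ∈ V, dist z x₀ = k * ρ) ∧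
      (∀ k c, ∀ V ∈ W k c, ∀ z ∈ V, ∀ w ∈ V, dist z w ≤ D) := by
  obtain ⟨ρ, hρ, 𝒰, -, ⟨lam, hlam, hL⟩, ⟨D, hD⟩, hmult⟩ := h
  have hD' : ∀ k, mesh (𝒰 k) ≤ ENNReal.ofReal |D| := fun k =>
    (hD k).trans (ENNReal.ofReal_le_ofReal (le_abs_self D))
  choose W hW1 hW2 hW3 using fun k =>
    exists_colored_cover hlam (abs_nonneg D) (hL k) (hD' k) (hmult k)
  refine ⟨ρ, lam / (2 * (n + 1)), |D|, hρ, by positivity,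
    fun k c => (fun V => Subtype.val '' V) '' W k c, ?_, ?_, ?_, ?_⟩
  · rintro k c _ ⟨V, hV, rfl⟩ _ ⟨V', hV', rfl⟩ _ ⟨z, hz, rfl⟩ ⟨z', hz', hzz⟩
    obtain rfl := Subtype.ext hzz
    rw [hW1 k c V hV V' hV' _ hz hz']
  · intro k y hy
    obtain ⟨c, V, hV, hb⟩ := hW2 k ⟨y, hy⟩
    exact ⟨c, _, ⟨V, hV, rfl⟩, fun z hz hzy => ⟨⟨z, hz⟩, hb hzy, rfl⟩⟩
  · rintro k c _ ⟨V, hV, rfl⟩ _ ⟨z, hz, rfl⟩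
    exact z.2
  · rintro k c _ ⟨V, hV, rfl⟩ _ ⟨z, hz, rfl⟩ _ ⟨w, hw, rfl⟩
    exact hW3 k c V hV z hz w hw

end CATAsdim

theorem mainTheorem5 (κ : ℝ) (hκ : κ < 0) (X : Type*) [MetricSpace X]
    (hX : CATAsdim.IsCATSpace κ X) (x₀ : X) (n : ℕ)
    (hn : CATAsdim.HasNicelyCoveredSpheres x₀ n) :
    CATAsdim.AsdimLE X n := by
  intro L hL
  obtain ⟨ρ, δ, D, hρ, hδ, W, hdisj, hleb, hsph, hdiam⟩ := hn.exists_colored_covers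
  -- `L` is for projecting balls of `X`, `D` for projecting members of one cover into the previous
  -- one; both must shrink below `δ`.
  obtain ⟨r₀, hr₀, hcontr⟩ := hX.exists_dist_radial_lt hκ x₀ (max L D) hδ
  -- The spacing `r = m * ρ` must hold all switching windows, and a ball lowered by `L` must still
  -- be `r₀` above its target sphere.
  obtain ⟨m, hm⟩ := exists_nat_ge (((2 * n + 3) * L + r₀) / ρ)
  rw [div_le_iff₀ hρ] at hm
  obtain ⟨r, hr⟩ : ∃ r, r = m * ρ := ⟨_, rfl⟩
  rw [← hr] at hm
  have hLr : L ≤ (2 * n + 3) * L := by nlinarith [(Nat.cast_nonneg n : (0 : ℝ) ≤ n)]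
  have hr0 : 0 < r := by linarith
  have hmul : ∀ k : ℕ, ((k * m : ℕ) : ℝ) * ρ = k * r := by
    intro k; rw [hr]; push_cast; ring
  refine CATAsdim.exists_cover_of_colored_covers (f := fun x => dist x₀ x)
    (π := fun k x => hX.1.radial x₀ (k * r) x) (W := fun k => W (k * m)) (D := D) hL
    (by linarith) (fun x => dist_nonneg) ?_ ?_ ?_ (fun k => hdisj _) (fun k => hdiam _) ?_ ?_ ?_
  · intro x y
    simpa [dist_comm x₀] using abs_dist_sub_le x y x₀
  · intro k x hx
    rw [dist_comm]
    exact (hX.1.dist_radial_right (by positivity) hx).le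
  · intro k x hx
    refine hX.radial_radial hκ (by positivity) ?_ (by exact_mod_cast hx)
    gcongr
    simp
  -- The sphere of radius `0` is the point `x₀`, so one member over it captures everything near the
  -- basepoint.
  · obtain ⟨c, V, hV, hz⟩ := hleb (0 * m) x₀ (by simp)
    have h0 : ∀ y, hX.1.radial x₀ ((0 : ℕ) * r) y = x₀ := fun y =>
      (dist_eq_zero.1 ((hX.1.dist_radial_left (by simp) (by simp)).trans (by simp))).symm
    exact ⟨c, V, hV, fun y => by rw [h0]; exact hz x₀ (by simp) (by simpa using hδ)⟩
  · intro k x hx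
    have hheight : ∀ y ∈ Metric.ball x L, ((k + 1 : ℕ) : ℝ) * r + r₀ ≤ dist x₀ y := by
      intro y hy
      rw [Metric.mem_ball] at hy
      push_cast
      linarith [dist_triangle x₀ y x]
    have hsphere : ∀ y ∈ Metric.ball x L,
        dist (hX.1.radial x₀ ((k + 1 : ℕ) * r) y) x₀ = ((k + 1) * m : ℕ) * ρ := by
      intro y hy
      rw [dist_comm, hmul]
      exact hX.1.dist_radial_left (by positivity) (by linarith [hheight y hy])
    have hxx := Metric.mem_ball_self (x := x) hL
    obtain ⟨c, V, hV, hz⟩ := hleb _ _ (hsphere x hxx)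
    exact ⟨c, V, hV, fun y hy => hz _ (hsphere y hy) (hcontr _ _ _ (by positivity)
      ((Metric.mem_ball.1 hy).le.trans (le_max_left _ _)) (hheight y hy) (hheight x hxx))⟩
  · rintro k c V hV ⟨v, hv⟩
    have hheight : ∀ z ∈ V, (k : ℝ) * r + r₀ ≤ dist x₀ z := by
      intro z hz
      rw [dist_comm, hsph _ c V hV z hz, hmul]
      push_cast
      linarith
    have hsphere : ∀ z ∈ V, dist (hX.1.radial x₀ (k * r) z) x₀ = (k * m : ℕ) * ρ := by
      intro z hz
      rw [dist_comm, hmul]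
      exact hX.1.dist_radial_left (by positivity) (by linarith [hheight z hz])
    obtain ⟨c', V', hV', hz'⟩ := hleb _ _ (hsphere v hv)
    exact ⟨c', V', hV', fun z hz => hz' _ (hsphere z hz) (hcontr _ _ _ (by positivity)
      ((hdiam _ c V hV z hz v hv).trans (le_max_right _ _)) (hheight z hz) (hheight v hv))⟩
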